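/- A merge tree $(T,f)$ is a finite rooted tree $T$ with a function $f:V(T)\to\mathbb{R}\cup\{\infty\}$ such that adjacent vertices have different values, every non-root vertex has exactly one neighbor of higher value, and the root has degree one and is the only vertex of value $\infty$. Two merge trees are considered to be the same if one is obtained from the other by a finite sequence of vertex renamings, subdivisions of an edge $uv$ with $f(u)<f(v)$ by a new vertex $w$ with $f(u)<f(w)<f(v)$, and inverses of these operations; $\mathsf{MT}$ is the resulting space of (unlabeled, finite) merge trees. Let $|T|$ be the metric tree of $(T,f)$, without its point at infinity: $f$ is extended linearly along the edges, the edge at the root is an infinite ray, and the distance of two points is the length of the path between them, where length is measured by the change of $f$. Write $u\preceq x$ if $x$ is an ancestor of $u$ (or $u=x$), i.e. if $f$ increases along the path from $u$ to $x$, let $\mathrm{LCA}(S)$ be the lowest common ancestor of a finite set $S\subset|T|$, and let $\mathrm{depth}(w)=\sup_{u\preceq w}(f(w)-f(u))$. For $\delta\in\mathbb{R}$, a $\delta$-good map $\alpha:(T,f)\to(T',f')$ is a continuous map $\alpha:|T|\to|T'|$ such that (i) $f'(\alpha(x))-f(x)=\delta$ for all $x\in|T|$; (ii) for every $w\in\mathrm{Im}(\alpha)$,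 with $x'=\mathrm{LCA}(\alpha^{-1}(w))$, one has $f(x')-f(u)\le 2\delta$ for all $u\in\alpha^{-1}(w)$; (iii) $\mathrm{depth}(w)\le 2\delta$ for every $w\in|T'|\setminus\mathrm{Im}(\alpha)$. The interleaving distance is $$d_I((T,f),(T',f'))=\inf\{\delta \mid \text{there is a }\delta\text{-good map }(T,f)\to(T',f')\};$$ it depends only on the classes of the two trees in $\mathsf{MT}$. For a path $\gamma:[0,1]\to\mathsf{MT}$ that is continuous with respect to $d_I$, let $$L_{d_I}(\gamma)=\sup\sum_{i=0}^{n-1}d_I(\gamma(t_i),\gamma(t_{i+1})),$$ the supremum being over all $n$ and all partitions $0=t_0\le t_1\le\dots\le t_n=1$. Let $\hat d_I(T,T')=\inf_\gamma L_{d_I}(\gamma)$, the infimum being over all continuous paths $\gamma$ with $\gamma(0)=T$ and $\gamma(1)=T'$. Theorem. On the space $\mathsf{MT}$ of finite (unlabeled) merge trees, $d_I=\hat d_I$; that is, $d_I(T,T')=\hat d_I(T,T')$ for all $T,T'\in\mathsf{MT}$. -/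

import Mathlib

open scoped ENNReal Topology

/-- A merge tree: a finite tree with a root and a height function `f : V → ℝ ∪ {∞}` such that
adjacent vertices have different heights, every non-root vertex has exactly one higher neighbour,
the root has degree one, and the root is the only vertex of height `∞`. -/
structure MergeTree where
  V : Type
  finite : Finite V
  G : SimpleGraph V
  isTree : G.IsTree
  root : V
  f : V → WithTop ℝ
  f_ne_of_adj : ∀ u v, G.Adj u v → f u ≠ f v
  existsUnique_higher : ∀ v, v ≠ root → ∃! w, G.Adj v w ∧ f v < f w
  root_degree_one : ∃! w, G.Adj root w
  f_eq_top_iff : ∀ v, f v = ⊤ ↔ v = root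

namespace MergeTree

attribute [instance] MergeTree.finite

/-- `T.Up u v`: `v` is the higher endpoint of an edge `uv`. -/
def Up (T : MergeTree) (u v : T.V) : Prop := T.G.Adj u v ∧ T.f u < T.f v

/-- `T.Below u v`: the vertex `v` is an ancestor of `u` (or equal to `u`), i.e. there is a
path from `u` to `v` along which `f` increases. -/
def Below (T : MergeTree) : T.V → T.V → Prop := Relation.ReflTransGen T.Up

theorem up_unique {T : MergeTree} {u v w : T.V} (hv : T.Up u v) (hw : T.Up u w) : v = w := by
  have hu : u ≠ T.root := by
    intro h
    have h2 := hv.2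
    rw [(T.f_eq_top_iff u).2 h] at h2
    exact not_top_lt h2
  exact (T.existsUnique_higher u hu).unique hv hw

theorem Below.f_le {T : MergeTree} {u v : T.V} (h : T.Below u v) : T.f u ≤ T.f v := by
  induction h with
  | refl => exact le_rfl
  | tail _ h ih => exact ih.trans h.2.le

theorem Below.eq_or {T : MergeTree} {u v : T.V} (h : T.Below u v) :
    u = v ∨ ∃ p, T.Up u p ∧ T.Below p v :=
  (Relation.ReflTransGen.cases_head h).imp id id

theorem Below.antisymm {T : MergeTree} {u v : T.V} (h : T.Below u v) (h' : T.f v ≤ T.f u) :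
    u = v := by
  rcases h.eq_or with h | ⟨p, hp, hpv⟩
  · exact h
  · exact absurd (hp.2.trans_le (hpv.f_le.trans h')) (lt_irrefl _)

theorem Below.total {T : MergeTree} {u v w : T.V} (hv : T.Below u v) (hw : T.Below u w) :
    T.Below v w ∨ T.Below w v :=
  Relation.ReflTransGen.total_of_right_unique (fun _ _ _ h h' => up_unique h h') hv hw

/-- Points of the metric tree `|T|`, at finite height.  Such a point lies on a unique half-open edge
`[u, v)` where `v` is the higher neighbour of `u`, and is recorded by its lower endpoint
`base = u` and its height, with `f u ≤ height < f v`.  The edge at the root is an infinite ray. -/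
@[ext]
structure Point (T : MergeTree) where
  base : T.V
  height : ℝ
  f_le : T.f base ≤ height
  lt_f : ∀ v, T.Up base v → (height : WithTop ℝ) < T.f v

/-- The ancestor order on `|T|`: `x ≤ y` iff the path from `x` to `y` is increasing in height. -/
instance (T : MergeTree) : PartialOrder T.Point where
  le x y := x.height ≤ y.height ∧ T.Below x.base y.base
  le_refl x := ⟨le_rfl, Relation.ReflTransGen.refl⟩
  le_trans x y z h h' := ⟨h.1.trans h'.1, Relation.ReflTransGen.trans h.2 h'.2⟩
  le_antisymm x y h h' :=
    Point.ext (h.2.antisymm h'.2.f_le) (le_antisymm h.1 h'.1)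

theorem Point.le_def {T : MergeTree} {x y : T.Point} :
    x ≤ y ↔ x.height ≤ y.height ∧ T.Below x.base y.base := Iff.rfl

theorem Point.lt_of_below_up {T : MergeTree} (x : T.Point) {c v : T.V} (h : T.Below x.base c)
    (hv : T.Up c v) : (x.height : WithTop ℝ) < T.f v := by
  rcases h.eq_or with h | ⟨p, hp, hpc⟩
  · exact x.lt_f v (h ▸ hv)
  · exact (x.lt_f p hp).trans_le (hpc.f_le.trans hv.2.le)

theorem Point.base_ne_root {T : MergeTree} (x : T.Point) : x.base ≠ T.root := by
  intro h
  have h2 := x.f_le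
  rw [(T.f_eq_top_iff _).2 h] at h2
  exact absurd h2 (not_le.2 (WithTop.coe_lt_top _))

/-- Two ancestors of the same point are comparable. -/
theorem Point.total_of_le {T : MergeTree} {x y z : T.Point} (hy : x ≤ y) (hz : x ≤ z) :
    y ≤ z ∨ z ≤ y := by
  have key : ∀ y z : T.Point, T.Below y.base z.base → y ≤ z ∨ z ≤ y := by
    intro y z h
    rcases h.eq_or with h' | ⟨p, hp, hpz⟩
    · rcases le_total y.height z.height with h1 | h1
      · exact Or.inl ⟨h1, h⟩
      · exact Or.inr ⟨h1, h' ▸ Relation.ReflTransGen.refl⟩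
    · refine Or.inl ⟨?_, h⟩
      exact WithTop.coe_le_coe.1 ((y.lt_f p hp).le.trans (hpz.f_le.trans z.f_le))
  rcases hy.2.total hz.2 with h | h
  · exact key y z h
  · exact (key z y h).symm

theorem exists_top_vertex (T : MergeTree) :
    ∃ r, r ≠ T.root ∧ ∀ v, v ≠ T.root → T.Below v r := by
  obtain ⟨r, hr, hru⟩ := T.root_degree_one
  refine ⟨r, fun h => T.G.loopless.irrefl _ (h ▸ hr), ?_⟩
  have wf : WellFounded (fun a b : T.V => T.f b < T.f a) :=
    @Finite.wellFounded_of_trans_of_irrefl _ _ _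
      ⟨fun _ _ _ h h' => lt_trans h' h⟩ ⟨fun _ h => lt_irrefl _ h⟩
  intro v
  induction v using wf.induction with
  | _ v ih =>
    intro hv
    obtain ⟨p, hp, -⟩ := T.existsUnique_higher v hv
    by_cases h : p = T.root
    · subst h
      rw [hru v hp.1.symm]
      exact Relation.ReflTransGen.refl
    · exact Relation.ReflTransGen.head hp (ih p hp.2 h)

/-- Any two points of `|T|` have a lowest common ancestor. -/
theorem exists_isLUB_pair {T : MergeTree} (x y : T.Point) : ∃ z, IsLUB {x, y} z := by
  obtain ⟨r, hr, hrv⟩ := T.exists_top_vertex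
  let S : Set T.V := {c | c ≠ T.root ∧ T.Below x.base c ∧ T.Below y.base c}
  have hS : S.Nonempty := ⟨r, hr, hrv _ x.base_ne_root, hrv _ y.base_ne_root⟩
  obtain ⟨c, ⟨hc, hxc, hyc⟩, hmin⟩ := S.exists_min_image T.f S.toFinite hS
  have hne : T.f c ≠ ⊤ := fun h => hc ((T.f_eq_top_iff c).1 h)
  obtain ⟨t, ht⟩ := WithTop.ne_top_iff_exists.1 hne
  refine ⟨⟨c, max t (max x.height y.height), ?_, ?_⟩, ?_, ?_⟩
  · rw [← ht]
    exact WithTop.coe_le_coe.2 (le_max_left _ _)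
  · intro v hv
    have h1 := x.lt_of_below_up hxc hv
    have h2 := y.lt_of_below_up hyc hv
    have h3 := hv.2
    rw [← ht] at h3
    rcases max_choice t (max x.height y.height) with h | h <;> rw [h]
    · exact h3
    · rcases max_choice x.height y.height with h | h <;> rw [h]
      · exact h1
      · exact h2
  · intro z hz
    rcases hz with rfl | rfl
    · exact ⟨(le_max_left _ _).trans (le_max_right _ _), hxc⟩
    · exact ⟨(le_max_right _ _).trans (le_max_right _ _), hyc⟩
  · intro z hz
    have hx : x ≤ z := hz (Set.mem_insert _ _)
    have hy : y ≤ z := hz (Set.mem_insert_of_mem _ rfl)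
    have hcz : T.f c ≤ T.f z.base := hmin z.base ⟨z.base_ne_root, hx.2, hy.2⟩
    refine ⟨max_le ?_ (max_le hx.1 hy.1), ?_⟩
    · apply WithTop.coe_le_coe.1
      rw [ht]
      exact hcz.trans z.f_le
    · rcases hxc.total hx.2 with h | h
      · exact h
      · show T.Below c z.base
        rw [h.antisymm hcz]
        exact Relation.ReflTransGen.refl

/-- `x ⊔ y` is the lowest common ancestor `LCA(x, y)` of two points of `|T|`. -/
noncomputable instance (T : MergeTree) : SemilatticeSup T.Point where
  sup x y := (exists_isLUB_pair x y).choose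
  le_sup_left x y := (exists_isLUB_pair x y).choose_spec.1 (Set.mem_insert _ _)
  le_sup_right x y := (exists_isLUB_pair x y).choose_spec.1 (Set.mem_insert_of_mem _ rfl)
  sup_le x y z hx hy := (exists_isLUB_pair x y).choose_spec.2 (by
    rintro w (rfl | rfl)
    · exact hx
    · exact hy)

theorem Point.eq_of_le_of_height_le {T : MergeTree} {x y : T.Point} (h : x ≤ y)
    (h' : y.height ≤ x.height) : x = y := by
  rcases h.2.eq_or with hb | ⟨p, hp, hpy⟩
  · exact Point.ext hb (le_antisymm h.1 h')
  · have h1 := (x.lt_f p hp).trans_le (hpy.f_le.trans y.f_le)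
    exact absurd (WithTop.coe_lt_coe.1 h1) (not_lt.2 h')

/-- The metric tree `|T|`: the path from `x` to `y` goes up to `LCA(x, y)` and down again, so its
length, with edges `uv` of length `|f u - f v|`, is
`(f (LCA(x, y)) - f x) + (f (LCA(x, y)) - f y)`. -/
noncomputable instance (T : MergeTree) : MetricSpace T.Point where
  dist x y := ((x ⊔ y).height - x.height) + ((x ⊔ y).height - y.height)
  dist_self x := by simp
  dist_comm x y := by rw [sup_comm, add_comm]
  dist_triangle x y z := by
    have hle : x ⊔ z ≤ (x ⊔ y) ⊔ (y ⊔ z) :=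
      sup_le (le_sup_left.trans le_sup_left) (le_sup_right.trans le_sup_right)
    have h1 : y.height ≤ (x ⊔ y).height := (le_sup_right : y ≤ x ⊔ y).1
    have h2 : y.height ≤ (y ⊔ z).height := (le_sup_left : y ≤ y ⊔ z).1
    rcases Point.total_of_le (le_sup_right : y ≤ x ⊔ y) (le_sup_left : y ≤ y ⊔ z) with h | h
    · rw [sup_eq_right.2 h] at hle
      have := hle.1
      linarith
    · rw [sup_eq_left.2 h] at hle
      have := hle.1
      linarith
  eq_of_dist_eq_zero {x y} h := by
    have h1 : x.height ≤ (x ⊔ y).height := (le_sup_left : x ≤ x ⊔ y).1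
    have h2 : y.height ≤ (x ⊔ y).height := (le_sup_right : y ≤ x ⊔ y).1
    have h3 : ((x ⊔ y).height - x.height) + ((x ⊔ y).height - y.height) = 0 := h
    rw [Point.eq_of_le_of_height_le (le_sup_left : x ≤ x ⊔ y) (by linarith)]
    exact (Point.eq_of_le_of_height_le (le_sup_right : y ≤ x ⊔ y) (by linarith)).symm

theorem Point.dist_def {T : MergeTree} (x y : T.Point) :
    dist x y = ((x ⊔ y).height - x.height) + ((x ⊔ y).height - y.height) := rfl

/-- The depth of a point: the largest height difference between it and a point below it. -/
noncomputable def Point.depth {T : MergeTree} (w : T.Point) : ℝ :=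
  sSup ((fun u : T.Point => w.height - u.height) '' Set.Iic w)

/-- The set of height differences defining the depth is bounded, so that `depth` is a true
supremum. -/
theorem Point.depth_bddAbove {T : MergeTree} (w : T.Point) :
    BddAbove ((fun u : T.Point => w.height - u.height) '' Set.Iic w) := by
  have : Nonempty T.V := ⟨T.root⟩
  obtain ⟨c, hc⟩ := Finite.exists_min T.f
  have hw : T.f c ≤ w.height := (hc w.base).trans w.f_le
  obtain ⟨t, ht⟩ := WithTop.ne_top_iff_exists.1 (ne_top_of_le_ne_top WithTop.coe_ne_top hw)
  refine ⟨w.height - t, ?_⟩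
  rintro _ ⟨u, -, rfl⟩
  have hu : T.f c ≤ u.height := (hc u.base).trans u.f_le
  rw [← ht] at hu
  have := WithTop.coe_le_coe.1 hu
  show w.height - u.height ≤ w.height - t
  linarith

/-- A `δ`-good map `α : |T| → |T'|`. -/
structure IsGood {T T' : MergeTree} (δ : ℝ) (α : T.Point → T'.Point) : Prop where
  continuous : Continuous α
  shift : ∀ x, (α x).height - x.height = δ
  /-- `x'` is the lowest common ancestor of the fibre of `α` over `w`. -/
  fibre : ∀ w ∈ Set.range α, ∃ x', IsLUB (α ⁻¹' {w}) x' ∧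
    ∀ u ∈ α ⁻¹' {w}, x'.height - u.height ≤ 2 * δ
  depth_le : ∀ w ∉ Set.range α, w.depth ≤ 2 * δ

/-- The interleaving distance: the infimum of all `δ` such that there is a `δ`-good map. -/
noncomputable def interleavingDist (T T' : MergeTree) : ℝ≥0∞ :=
  ⨅ (δ : ℝ) (_ : ∃ α : T.Point → T'.Point, IsGood δ α), ENNReal.ofReal δ

/-- `T'` is obtained from `T` by renaming the vertices. -/
def Renaming (T T' : MergeTree) : Prop :=
  ∃ e : T.G ≃g T'.G, ∀ v, T'.f (e v) = T.f v

/-- `T'` is obtained from `T` by subdividing an edge `uv`, with `f u < f v`, by one new vertex `w`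
with `f u < f w < f v`.  The map `i` includes the old vertices into the new ones. -/
def Subdivision (T T' : MergeTree) : Prop :=
  ∃ (i : T.V → T'.V) (u v : T.V) (w : T'.V),
    Function.Injective i ∧ (∀ b, b ≠ w ↔ b ∈ Set.range i) ∧ (∀ a, T'.f (i a) = T.f a) ∧
    T.G.Adj u v ∧ T.f u < T'.f w ∧ T'.f w < T.f v ∧
    (∀ a, T'.G.Adj (i a) w ↔ a = u ∨ a = v) ∧
    ∀ a b, T'.G.Adj (i a) (i b) ↔
      T.G.Adj a b ∧ ¬ (a = u ∧ b = v) ∧ ¬ (a = v ∧ b = u)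

/-- Two merge trees are considered to be the same if one can be obtained from the other by a
sequence of subdivisions and inverse subdivisions (and renamings of vertices). -/
def same : Setoid MergeTree :=
  Relation.EqvGen.setoid fun T T' => Renaming T T' ∨ Subdivision T T'

/-- Height-preserving order isomorphism of the metric trees (auxiliary). -/
def RealIso (T T' : MergeTree) : Prop :=
  ∃ e : T.Point ≃o T'.Point, ∀ x, (e x).height = x.height

theorem RealIso.symm {T T' : MergeTree} : RealIso T T' → RealIso T' T
  | ⟨e, he⟩ => ⟨e.symm, fun x => by rw [← he, e.apply_symm_apply]⟩

theorem RealIso.of_map {T T' : MergeTree} (φ : T.Point → T'.Point)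
    (hh : ∀ x, (φ x).height = x.height) (hle : ∀ x y, φ x ≤ φ y ↔ x ≤ y)
    (hs : Function.Surjective φ) : RealIso T T' :=
  ⟨RelIso.ofSurjective (OrderEmbedding.ofMapLEIff φ hle) hs, hh⟩

theorem Renaming.realIso {T T' : MergeTree} : Renaming T T' → RealIso T T' := by
  rintro ⟨e, he⟩
  have hup : ∀ a b, T'.Up (e a) (e b) ↔ T.Up a b := by
    intro a b
    simp only [Up, he, SimpleGraph.Iso.map_adj_iff]
  have hbel : ∀ a b, T.Below a b → T'.Below (e a) (e b) := by
    intro a b h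
    exact Relation.ReflTransGen.lift e (fun a b h => (hup a b).2 h) _ _ h
  have hbel' : ∀ a b, T'.Below a b → T.Below (e.symm a) (e.symm b) := by
    intro a b h
    refine Relation.ReflTransGen.lift e.symm (fun a b h => (hup _ _).1 ?_) _ _ h
    simpa using h
  refine RealIso.of_map (fun x => ⟨e x.base, x.height, by rw [he]; exact x.f_le, ?_⟩)
    (fun _ => rfl) ?_ ?_
  · intro v hv
    have h1 : T.Up x.base (e.symm v) := (hup _ _).1 (by simpa using hv)
    have h2 := x.lt_f _ h1
    rw [← he] at h2
    simpa using h2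
  · intro x y
    simp only [Point.le_def]
    refine and_congr_right fun _ => ⟨fun h => ?_, hbel _ _⟩
    simpa using hbel' _ _ h
  · intro y
    refine ⟨⟨e.symm y.base, y.height, ?_, ?_⟩, ?_⟩
    · rw [← he]; simpa using y.f_le
    · intro v hv
      rw [← he]
      exact y.lt_f _ (by simpa using (hup _ _).2 hv)
    · exact Point.ext (by simp) rfl

theorem Subdivision.realIso {T T' : MergeTree} : Subdivision T T' → RealIso T' T := by
  rintro ⟨i, u, v, w, hinj, hrange, hf, huv, huw, hwv, hadjw, hadj⟩
  have hiw : ∀ a, i a ≠ w := fun a => (hrange _).2 ⟨a, rfl⟩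
  have hUuv : T.Up u v := ⟨huv, huw.trans hwv⟩
  have hUuw : T'.Up (i u) w := ⟨(hadjw u).2 (Or.inl rfl), by rw [hf]; exact huw⟩
  have hUwv : T'.Up w (i v) := ⟨((hadjw v).2 (Or.inr rfl)).symm, by rw [hf]; exact hwv⟩
  -- upward edges which are not subdivided
  have hup : ∀ a b, T.Up a b → a ≠ u → T'.Up (i a) (i b) := by
    intro a b h ha
    refine ⟨(hadj a b).2 ⟨h.1, fun h' => ha h'.1, ?_⟩, by rw [hf, hf]; exact h.2⟩
    rintro ⟨rfl, rfl⟩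
    exact lt_asymm h.2 hUuv.2
  have hbel : ∀ a b, T.Below a b → T'.Below (i a) (i b) := by
    intro a b h
    induction h with
    | refl => exact Relation.ReflTransGen.refl
    | @tail b c _ hbc ih =>
      by_cases hb : b = u
      · subst hb
        rw [up_unique hbc hUuv]
        exact (Relation.ReflTransGen.tail ih hUuw).tail hUwv
      · exact Relation.ReflTransGen.tail ih (hup b c hbc hb)
  -- the retraction sending the new vertex to the lower endpoint
  have hcases : ∀ b : T'.V, b = w ∨ ∃ a, i a = b := fun b =>
    (em (b = w)).imp id (fun h => (hrange b).1 h)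
  obtain ⟨r, hri, hrw⟩ : ∃ r : T'.V → T.V, (∀ a, r (i a) = a) ∧ r w = u := by
    classical
    refine ⟨fun b => if h : ∃ a, i a = b then h.choose else u, fun a => ?_, ?_⟩
    · have h : ∃ a', i a' = i a := ⟨a, rfl⟩
      simp only [dif_pos h]
      exact hinj h.choose_spec
    · have h : ¬ ∃ a, i a = w := fun ⟨a, ha⟩ => hiw a ha
      simp only [dif_neg h]
  have hrup : ∀ a b, T'.Up a b → T.Below (r a) (r b) := by
    intro a b h
    rcases hcases a with rfl | ⟨a, rfl⟩
    · rw [up_unique h hUwv, hrw, hri]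
      exact Relation.ReflTransGen.single hUuv
    · by_cases ha : a = u
      · subst ha
        rw [up_unique h hUuw, hrw, hri]
        exact Relation.ReflTransGen.refl
      · rcases hcases b with rfl | ⟨b, rfl⟩
        · rcases (hadjw a).1 h.1 with h' | h'
          · exact absurd h' ha
          · subst h'
            exact absurd h.2 (lt_asymm hUwv.2)
        · rw [hri, hri]
          refine Relation.ReflTransGen.single ⟨((hadj a b).1 h.1).1, ?_⟩
          have := h.2
          rwa [hf, hf] at this
  have hrbel : ∀ a b, T'.Below a b → T.Below (r a) (r b) := by
    intro a b h
    induction h with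
    | refl => exact Relation.ReflTransGen.refl
    | tail _ hbc ih => exact Relation.ReflTransGen.trans ih (hrup _ _ hbc)
  refine RealIso.of_map (fun x => ⟨r x.base, x.height, ?_, ?_⟩) (fun _ => rfl) ?_ ?_
  · rcases hcases x.base with h | ⟨a, h⟩
    · rw [h, hrw]
      exact huw.le.trans (h ▸ x.f_le)
    · rw [← h, hri, ← hf, h]
      exact x.f_le
  · intro p hp
    rcases hcases x.base with h | ⟨a, h⟩
    · rw [h, hrw] at hp
      rw [up_unique hp hUuv, ← hf]
      exact x.lt_f _ (by rw [h]; exact hUwv)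
    · rw [← h, hri] at hp
      by_cases ha : a = u
      · subst ha
        rw [up_unique hp hUuv]
        exact (x.lt_f w (by rw [← h]; exact hUuw)).trans hwv
      · rw [← hf]
        exact x.lt_f _ (by rw [← h]; exact hup _ _ hp ha)
  · intro x y
    simp only [Point.le_def]
    refine and_congr_right fun hxy => ⟨fun h => ?_, hrbel _ _⟩
    rcases hcases x.base with hx | ⟨a, hx⟩ <;> rcases hcases y.base with hy | ⟨b, hy⟩
    · rw [hx, hy]; exact Relation.ReflTransGen.refl
    · rw [hx, ← hy, hrw, hri] at h
      rw [hx, ← hy]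
      rcases h.eq_or with h | ⟨p, hp, hpb⟩
      · exfalso
        have h1 : T'.f w ≤ x.height := hx ▸ x.f_le
        have h2 : (y.height : WithTop ℝ) < T'.f w := y.lt_f w (by rw [← hy, ← h]; exact hUuw)
        exact absurd (WithTop.coe_lt_coe.1 (h2.trans_le h1)) (not_lt.2 hxy)
      · rw [up_unique hp hUuv] at hpb
        exact Relation.ReflTransGen.head hUwv (hbel _ _ hpb)
    · rw [← hx, hy, hrw, hri] at h
      rw [← hx, hy]
      exact Relation.ReflTransGen.tail (hbel _ _ h) hUuw
    · rw [← hx, ← hy, hri, hri] at h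
      rw [← hx, ← hy]
      exact hbel _ _ h
  · intro y
    by_cases hy : y.base = u ∧ T'.f w ≤ y.height
    · refine ⟨⟨w, y.height, hy.2, ?_⟩, Point.ext ?_ rfl⟩
      · intro p hp
        rw [up_unique hp hUwv, hf]
        exact y.lt_f _ (by rw [hy.1]; exact hUuv)
      · simp only [hrw, hy.1]
    · refine ⟨⟨i y.base, y.height, by rw [hf]; exact y.f_le, ?_⟩, Point.ext ?_ rfl⟩
      · intro p hp
        by_cases hu : y.base = u
        · rw [hu] at hp
          rw [up_unique hp hUuw]
          exact not_le.1 fun h => hy ⟨hu, h⟩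
        · obtain ⟨q, hq, -⟩ := T.existsUnique_higher y.base y.base_ne_root
          rw [up_unique hp (hup _ _ hq hu), hf]
          exact y.lt_f _ hq
      · simp only [hri]

theorem IsGood.transport {T T' S S' : MergeTree} {δ : ℝ} {α : T.Point → T'.Point}
    (h : IsGood δ α) (e : S.Point ≃o T.Point) (he : ∀ x, (e x).height = x.height)
    (e' : T'.Point ≃o S'.Point) (he' : ∀ x, (e' x).height = x.height) :
    IsGood δ (fun x => e' (α (e x))) := by
  have iso : ∀ {A B : MergeTree} (g : A.Point ≃o B.Point), (∀ x, (g x).height = x.height) →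
      Isometry g := by
    intro A B g hg
    refine Isometry.of_dist_eq fun x y => ?_
    rw [Point.dist_def, Point.dist_def, ← g.map_sup, hg, hg, hg]
  have hpre : ∀ w, (fun x => e' (α (e x))) ⁻¹' {w} = e ⁻¹' (α ⁻¹' {e'.symm w}) := by
    intro w
    ext x
    simp only [Set.mem_preimage, Set.mem_singleton_iff]
    exact e'.toEquiv.eq_symm_apply.symm
  have hran : ∀ w, w ∈ Set.range (fun x => e' (α (e x))) ↔ e'.symm w ∈ Set.range α := by
    intro w
    constructor
    · rintro ⟨x, rfl⟩
      exact ⟨e x, by simp⟩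
    · rintro ⟨x, hx⟩
      exact ⟨e.symm x, by simp [hx]⟩
  refine ⟨(iso e' he').continuous.comp (h.continuous.comp (iso e he).continuous), ?_, ?_, ?_⟩
  · intro x
    have := h.shift (e x)
    rw [he] at this
    simpa [he'] using this
  · intro w hw
    obtain ⟨x', hx', hb⟩ := h.fibre _ ((hran w).1 hw)
    rw [hpre]
    refine ⟨e.symm x', ?_, ?_⟩
    · rw [e.isLUB_preimage]
      simpa using hx'
    · intro u hu
      have h1 := hb (e u) hu
      rw [he] at h1
      rwa [← he (e.symm x'), e.apply_symm_apply]
  · intro w hw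
    have h1 := h.depth_le (e'.symm w) (fun hh => hw ((hran w).2 hh))
    have hs : ∀ x, (e'.symm x).height = x.height := fun x => by
      rw [← he', e'.apply_symm_apply]
    refine le_trans (le_of_eq ?_) h1
    unfold Point.depth
    congr 1
    ext t
    constructor
    · rintro ⟨x, hx, rfl⟩
      exact ⟨e'.symm x, e'.symm.le_iff_le.2 hx, by simp only [hs]⟩
    · rintro ⟨x, hx, rfl⟩
      refine ⟨e' x, ?_, by simp only [hs, he']⟩
      have := e'.le_iff_le.2 (Set.mem_Iic.1 hx)
      rwa [e'.apply_symm_apply] at this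

theorem interleavingDist_congr {T T' S S' : MergeTree} (h : RealIso T S) (h' : RealIso T' S') :
    interleavingDist T T' = interleavingDist S S' := by
  have key : ∀ {T T' S S' : MergeTree}, RealIso T S → RealIso T' S' →
      interleavingDist S S' ≤ interleavingDist T T' := by
    intro T T' S S' h h'
    obtain ⟨e, he⟩ := h.symm
    obtain ⟨e', he'⟩ := h'
    refine le_iInf₂ fun δ hδ => ?_
    obtain ⟨α, hα⟩ := hδ
    exact iInf₂_le δ ⟨_, hα.transport e he e' he'⟩
  exact le_antisymm (key h.symm h'.symm) (key h h')

theorem realIso_of_same {T T' : MergeTree} (h : same T T') : RealIso T T' := by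
  have h' : Relation.EqvGen (fun T T' => Renaming T T' ∨ Subdivision T T') T T' := h
  clear h
  induction h' with
  | rel T T' h =>
    rcases h with h | h
    · exact h.realIso
    · exact h.realIso.symm
  | refl T => exact ⟨OrderIso.refl _, fun _ => rfl⟩
  | symm T T' _ ih => exact ih.symm
  | trans T T' T'' _ _ ih ih' =>
    obtain ⟨e, he⟩ := ih
    obtain ⟨e', he'⟩ := ih'
    exact ⟨e.trans e', fun x => by simp [he, he']⟩

end MergeTree

/-- The space `MT` of finite (unlabeled) merge trees, up to subdivision. -/
def MTSpace : Type 1 := Quotient MergeTree.same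

/-- The interleaving distance `d_I` on the space of merge trees. -/
noncomputable def MTSpace.dI : MTSpace → MTSpace → ℝ≥0∞ :=
  Quotient.lift₂ MergeTree.interleavingDist fun _ _ _ _ h h' =>
    MergeTree.interleavingDist_congr (MergeTree.realIso_of_same h) (MergeTree.realIso_of_same h')

/-- A path `γ : [0,1] → X` is continuous with respect to the distance `d`. -/
def ContinuousPath {X : Type*} (d : X → X → ℝ≥0∞) (γ : unitInterval → X) : Prop :=
  ∀ t, Filter.Tendsto (fun s => d (γ t) (γ s)) (𝓝 t) (𝓝 0)

/-- The length of `γ` induced by `d`: the supremum of `∑ i < n, d (γ tᵢ) (γ tᵢ₊₁)` over all `n`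
and all partitions `0 = t₀ ≤ t₁ ≤ ⋯ ≤ tₙ = 1`. -/
noncomputable def pathLength {X : Type*} (d : X → X → ℝ≥0∞) (γ : unitInterval → X) : ℝ≥0∞ :=
  ⨆ (n : ℕ) (t : ℕ → unitInterval) (_ : Monotone t ∧ t 0 = 0 ∧ t n = 1),
    ∑ i ∈ Finset.range n, d (γ (t i)) (γ (t (i + 1)))

/-- The intrinsic metric induced by `d`: the infimum of the lengths of the continuous paths
from `x` to `y`. -/
noncomputable def intrinsicDist {X : Type*} (d : X → X → ℝ≥0∞) (x y : X) : ℝ≥0∞ :=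
  ⨅ (γ : unitInterval → X) (_ : ContinuousPath d γ ∧ γ 0 = x ∧ γ 1 = y), pathLength d γ

/-!
A `δ`-good map `α` gives labellings of the two trees by the same finite set: the vertices of the
source go to their images, and each vertex of the target is matched with a preimage of its lowest
ancestor in the image. The heights of the lowest common ancestors of corresponding pairs of labels
then differ by at most `δ`. Conversely, labelled trees with `δ`-close matrices of such heights
are related by a `δ`-good map, which sends each point to the ancestor of the matching label that
lies `δ` higher than the point.

So one interpolates linearly between the two matrices. The intermediate matrices need not be
ultrametric, but the largest ultrametric matrix below each of them is the height matrix of a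
labelled merge tree. Passing to it does not increase sup-distances and fixes the two ends, so these
trees form a path of length at most `δ`. The length of any path is at least the distance of its
ends, by the partition into one interval.
-/

namespace MergeTree

namespace Point

variable {T : MergeTree} {x y z : T.Point}

theorem height_mono : Monotone (height : T.Point → ℝ) := fun _ _ h => h.1

theorem le_of_le_of_height_le (hy : x ≤ y) (hz : x ≤ z) (h : y.height ≤ z.height) : y ≤ z :=
  (total_of_le hy hz).elim id fun h' => (eq_of_le_of_height_le h' h).ge

theorem eq_of_le_of_height_eq (hy : x ≤ y) (hz : x ≤ z) (h : y.height = z.height) : y = z :=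
  eq_of_le_of_height_le (le_of_le_of_height_le hy hz h.le) h.ge

theorem le_iff_height_sup_le (hx : x ≤ z) : y ≤ z ↔ (x ⊔ y).height ≤ z.height :=
  ⟨fun hy => height_mono (sup_le hx hy),
    fun h => le_sup_right.trans (le_of_le_of_height_le le_sup_left hx h)⟩

theorem exists_ancestor (x : T.Point) {t : ℝ} (h : x.height ≤ t) : ∃ y, x ≤ y ∧ y.height = t := by
  let S : Set T.V := {c | T.Below x.base c ∧ T.f c ≤ t}
  have hS : S.Nonempty :=
    ⟨x.base, Relation.ReflTransGen.refl, x.f_le.trans (WithTop.coe_le_coe.2 h)⟩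
  obtain ⟨c, ⟨hc, hct⟩, hmax⟩ := S.exists_max_image T.f S.toFinite hS
  refine ⟨⟨c, t, hct, fun v hv => ?_⟩, ⟨h, hc⟩, rfl⟩
  by_contra! hvt
  exact (hmax v ⟨hc.tail hv, hvt⟩).not_gt hv.2

/-- The ancestor of `x` at height `t`. If `t` is lower than `x`, this is `x` itself. -/
noncomputable def ancestor (x : T.Point) (t : ℝ) : T.Point :=
  (x.exists_ancestor (le_max_left x.height t)).choose

theorem le_ancestor (x : T.Point) (t : ℝ) : x ≤ x.ancestor t :=
  (x.exists_ancestor (le_max_left x.height t)).choose_spec.1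

theorem height_ancestor (x : T.Point) (t : ℝ) : (x.ancestor t).height = max x.height t :=
  (x.exists_ancestor (le_max_left x.height t)).choose_spec.2

theorem height_ancestor_of_le {t : ℝ} (h : x.height ≤ t) : (x.ancestor t).height = t := by
  rw [height_ancestor, max_eq_right h]

theorem ancestor_height_of_le (h : x ≤ y) : x.ancestor y.height = y :=
  eq_of_le_of_height_eq (x.le_ancestor _) h (height_ancestor_of_le h.1)

theorem ancestor_mono (x : T.Point) : Monotone x.ancestor := fun s t h => by
  refine le_of_le_of_height_le (x.le_ancestor s) (x.le_ancestor t) ?_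
  simpa only [height_ancestor] using max_le_max_left x.height h

/-- The supremum is the ancestor of any member `x` at the supremum of the heights of the pairwise
lowest common ancestors of `x` with the other members. -/
theorem exists_isLUB {S : Set T.Point} (hS : S.Nonempty) (hb : BddAbove S) : ∃ z, IsLUB S z := by
  obtain ⟨x, hx⟩ := hS
  obtain ⟨p, hp⟩ := hb
  let H : Set ℝ := (fun y => (x ⊔ y).height) '' S
  have hH_le : ∀ q ∈ upperBounds S, ∀ h ∈ H, h ≤ q.height := by
    rintro q hq _ ⟨y, hy, rfl⟩
    exact height_mono (sup_le (hq hx) (hq hy))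
  have hH_mem : ∀ y ∈ S, (x ⊔ y).height ≤ sSup H := fun y hy =>
    le_csSup ⟨p.height, hH_le p hp⟩ ⟨y, hy, rfl⟩
  have hz : (x.ancestor (sSup H)).height = sSup H :=
    height_ancestor_of_le (by simpa using hH_mem x hx)
  refine ⟨x.ancestor (sSup H), fun y hy => ?_, fun q hq => ?_⟩
  · exact (le_iff_height_sup_le (x.le_ancestor _)).2 ((hH_mem y hy).trans_eq hz.symm)
  · exact le_of_le_of_height_le (x.le_ancestor _) (hq hx)
      (hz.trans_le (csSup_le ⟨_, x, hx, rfl⟩ (hH_le q hq)))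

theorem depth_le_iff {r : ℝ} : x.depth ≤ r ↔ ∀ u ≤ x, x.height - u.height ≤ r :=
  (csSup_le_iff x.depth_bddAbove (Set.nonempty_Iic.image _)).trans Set.forall_mem_image

/-- The point of `|T|` at a vertex other than the root. -/
def ofVertex (v : {v // v ≠ T.root}) : T.Point where
  base := v
  height := (T.f v).untop fun h => v.2 ((T.f_eq_top_iff v).1 h)
  f_le := (WithTop.coe_untop _ _).ge
  lt_f _ hw := by simpa only [WithTop.coe_untop] using hw.2

theorem ofVertex_base_le (x : T.Point) : ofVertex ⟨x.base, x.base_ne_root⟩ ≤ x :=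
  ⟨(WithTop.untop_le_iff _).2 x.f_le, Relation.ReflTransGen.refl⟩

instance : Nonempty T.Point :=
  let ⟨r, hr, _⟩ := T.exists_top_vertex
  ⟨ofVertex ⟨r, hr⟩⟩

theorem height_le_height_add_dist (x y : T.Point) : x.height ≤ y.height + dist x y := by
  have hx := height_mono (le_sup_left : x ≤ x ⊔ y)
  rw [dist_def]
  linarith

theorem continuous_height : Continuous (height : T.Point → ℝ) :=
  (LipschitzWith.of_le_add height_le_height_add_dist).continuous

theorem continuous_height_sup (x : T.Point) : Continuous fun y => (x ⊔ y).height := by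
  have h : ∀ y, (x ⊔ y).height = (dist x y + x.height + y.height) / 2 := fun y => by
    rw [dist_def]
    ring
  simp only [h]
  exact ((continuous_const.dist continuous_id).add_const _ |>.add continuous_height).div_const 2

theorem isClosed_Ici (x : T.Point) : IsClosed (Set.Ici x) := by
  have h : Set.Ici x = {y | (x ⊔ y).height ≤ y.height} := Set.ext fun y => by
    rw [Set.mem_Ici, Set.mem_ofPred_eq, sup_comm, ← le_iff_height_sup_le le_rfl]
  rw [h]
  exact isClosed_le x.continuous_height_sup continuous_height

theorem dist_of_le (h : x ≤ y) : dist x y = y.height - x.height := by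
  rw [dist_def, sup_eq_right.2 h]
  ring

theorem continuous_ancestor (x : T.Point) : Continuous x.ancestor := by
  refine (LipschitzWith.of_dist_le_mul (K := 1) fun s t => ?_).continuous
  wlog h : s ≤ t generalizing s t
  · simpa only [dist_comm] using this t s (le_of_not_ge h)
  rw [dist_of_le (x.ancestor_mono h), height_ancestor, height_ancestor, NNReal.coe_one, one_mul,
    dist_comm, Real.dist_eq]
  refine (le_abs_self _).trans ((abs_max_sub_max_le_max _ _ _ _).trans ?_)
  rw [sub_self, abs_zero, max_eq_right (abs_nonneg _)]

theorem base_eq_of_le_of_lt {v : T.V} (h : x ≤ y) (hv : T.Up x.base v)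
    (hlt : (y.height : WithTop ℝ) < T.f v) : x.base = y.base := by
  rcases h.2.eq_or with h | ⟨p, hp, hpy⟩
  · exact h
  · rw [up_unique hv hp] at hlt
    exact absurd (hpy.f_le.trans y.f_le) hlt.not_ge

theorem le_of_base_below (h : x.height ≤ y.height) (hb : T.Below y.base x.base) : x ≤ y := by
  rcases hb.eq_or with hb | ⟨p, hp, hpx⟩
  · exact ⟨h, hb ▸ Relation.ReflTransGen.refl⟩
  · have hlt := (y.lt_f p hp).trans_le (hpx.f_le.trans x.f_le)
    exact absurd h (WithTop.coe_lt_coe.1 hlt).not_ge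

/-- Below the next vertex above `x`, the tree has no branch that `x` does not lie on. -/
theorem eventually_le_of_height_le (x : T.Point) : ∀ᶠ y in 𝓝 x, x.height ≤ y.height → x ≤ y := by
  obtain ⟨v, hv⟩ := (T.existsUnique_higher _ x.base_ne_root).exists
  have hopen : IsOpen {t : ℝ | (t : WithTop ℝ) < T.f v} := by
    induction T.f v using WithTop.recTopCoe with
    | top => simp
    | coe a => simpa only [WithTop.coe_lt_coe] using! isOpen_Iio
  have hnear : ∀ᶠ y in 𝓝 x, ((x ⊔ y).height : WithTop ℝ) < T.f v :=
    x.continuous_height_sup.continuousAt.eventually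
      (hopen.mem_nhds (by simpa using x.lt_f v hv))
  filter_upwards [hnear] with y hy hxy
  exact le_of_base_below hxy
    (base_eq_of_le_of_lt le_sup_left hv hy ▸ (le_sup_right : y ≤ x ⊔ y).2)

theorem monotone_of_continuous_of_monotone_height {q : ℝ → T.Point} (hq : Continuous q)
    (hmono : Monotone fun t => (q t).height) : Monotone q := by
  intro s t hst
  have hsub : Set.Icc s t ⊆ q ⁻¹' Set.Ici (q s) := by
    refine IsClosed.Icc_subset_of_forall_mem_nhdsWithin ?_ (le_refl (q s)) ?_
    · exact ((isClosed_Ici (q s)).preimage hq).inter isClosed_Icc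
    · rintro r ⟨hsr, -⟩
      filter_upwards [nhdsWithin_le_nhds (hq.tendsto r (q r).eventually_le_of_height_le),
        self_mem_nhdsWithin] with u hu hru
      exact le_trans hsr (hu (hmono (le_of_lt hru)))
  exact hsub ⟨hst, le_rfl⟩

end Point

variable {T T' : MergeTree} {δ : ℝ} {α : T.Point → T'.Point}

theorem lipschitzWith_of_monotone (hδ : ∀ x, (α x).height - x.height = δ) (hα : Monotone α) :
    LipschitzWith 1 α := by
  refine LipschitzWith.of_dist_le_mul fun x y => ?_
  have hsup : (α x ⊔ α y).height ≤ (α (x ⊔ y)).height :=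
    Point.height_mono (hα.le_map_sup x y)
  rw [Point.dist_def, Point.dist_def, NNReal.coe_one, one_mul]
  linarith [hδ x, hδ y, hδ (x ⊔ y)]

theorem monotone_of_continuous (hδ : ∀ x, (α x).height - x.height = δ) (hα : Continuous α) :
    Monotone α := by
  intro x y hxy
  have hmono : Monotone (α ∘ x.ancestor) := by
    refine Point.monotone_of_continuous_of_monotone_height (hα.comp x.continuous_ancestor) ?_
    have h : ∀ t, (α (x.ancestor t)).height = (x.ancestor t).height + δ := fun t => by
      linarith [hδ (x.ancestor t)]
    simp only [Function.comp_apply, h]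
    exact (Point.height_mono.comp x.ancestor_mono).add_const δ
  simpa only [Function.comp_apply, Point.ancestor_height_of_le le_rfl,
    Point.ancestor_height_of_le hxy] using hmono hxy.1

theorem exists_map_eq_of_le (hδ : ∀ x, (α x).height - x.height = δ) (hα : Monotone α)
    {x : T.Point} {y : T'.Point} (hxy : α x ≤ y) : ∃ z, x ≤ z ∧ α z = y := by
  have hz : (x.ancestor (y.height - δ)).height = y.height - δ :=
    Point.height_ancestor_of_le (by linarith [hδ x, hxy.1])
  refine ⟨x.ancestor (y.height - δ), x.le_ancestor _, ?_⟩
  refine Point.eq_of_le_of_height_eq (hα (x.le_ancestor _)) hxy ?_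
  linarith [hδ (x.ancestor (y.height - δ))]

end MergeTree

namespace MergeTree

section Labelling

variable {ι : Type*} {T S : MergeTree}

/-- A family of points of `|T|` that has a member below every point of `|T|`. The labels need not
sit at leaves, and one point may carry several labels. -/
def IsLabelling (a : ι → T.Point) : Prop := ∀ x, ∃ i, a i ≤ x

/-- The matrix of the heights of the lowest common ancestors of a family of points; its diagonal
records the heights of the points themselves. -/
noncomputable def inducedMatrix (a : ι → T.Point) (i j : ι) : ℝ := (a i ⊔ a j).height

theorem inducedMatrix_self (a : ι → T.Point) (i : ι) : inducedMatrix a i i = (a i).height := by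
  rw [inducedMatrix, sup_idem]

theorem isLabelling_ofVertex (T : MergeTree) : IsLabelling (Point.ofVertex (T := T)) :=
  fun x => ⟨_, x.ofVertex_base_le⟩

variable {a : ι → T.Point} {b : ι → S.Point} {ε : ℝ} {α : T.Point → S.Point}

theorem IsLabelling.exists_shift (ha : IsLabelling a)
    (h : ∀ i j, inducedMatrix b i j ≤ inducedMatrix a i j + ε) :
    ∃ α : T.Point → S.Point, (∀ x, (α x).height - x.height = ε) ∧ ∀ x i, a i ≤ x → b i ≤ α x := by
  choose l hl using ha
  have hheight (x : T.Point) : ((b (l x)).ancestor (x.height + ε)).height = x.height + ε := by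
    refine Point.height_ancestor_of_le ?_
    have hself := h (l x) (l x)
    rw [inducedMatrix_self, inducedMatrix_self] at hself
    linarith [(hl x).1]
  refine ⟨fun x => (b (l x)).ancestor (x.height + ε), fun x => by linarith [hheight x],
    fun x i hi => ?_⟩
  rw [Point.le_iff_height_sup_le ((b (l x)).le_ancestor _), hheight]
  exact (h (l x) i).trans (add_le_add_left (Point.height_mono (sup_le (hl x) hi)) ε)

theorem IsLabelling.monotone_shift (ha : IsLabelling a)
    (hα : ∀ x, (α x).height - x.height = ε) (hb : ∀ x i, a i ≤ x → b i ≤ α x) : Monotone α := by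
  intro x y hxy
  obtain ⟨i, hi⟩ := ha x
  exact Point.le_of_le_of_height_le (hb x i hi) (hb y i (hi.trans hxy))
    (by linarith [hα x, hα y, hxy.1])

theorem IsLabelling.le_ancestor_of_shift_eq (ha : IsLabelling a) (hε : 0 ≤ ε)
    (hα : ∀ x, (α x).height - x.height = ε) (hb : ∀ x i, a i ≤ x → b i ≤ α x)
    (h : ∀ i j, inducedMatrix a i j ≤ inducedMatrix b i j + ε) {u v : T.Point} (huv : α u = α v) :
    v ≤ u.ancestor (u.height + 2 * ε) := by
  obtain ⟨i, hi⟩ := ha u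
  obtain ⟨j, hj⟩ := ha v
  have hheight : (u.ancestor (u.height + 2 * ε)).height = u.height + 2 * ε :=
    Point.height_ancestor_of_le (by linarith)
  have hsup : inducedMatrix b i j ≤ (α u).height :=
    Point.height_mono (sup_le (hb u i hi) (huv ▸ hb v j hj))
  have haj : a j ≤ u.ancestor (u.height + 2 * ε) := by
    rw [Point.le_iff_height_sup_le (hi.trans (u.le_ancestor _)), hheight]
    exact (h i j).trans (by linarith [hα u])
  refine Point.le_of_le_of_height_le hj haj ?_
  have huv_height := congrArg Point.height huv
  linarith [hα u, hα v]

theorem IsLabelling.depth_le_of_notMem_range (hlb : IsLabelling b) (hmono : Monotone α)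
    (hα : ∀ x, (α x).height - x.height = ε) (hb : ∀ x i, a i ≤ x → b i ≤ α x)
    (h : ∀ i, (a i).height ≤ (b i).height + ε) {w : S.Point} (hw : w ∉ Set.range α) :
    w.depth ≤ 2 * ε := by
  refine Point.depth_le_iff.2 fun u hu => ?_
  obtain ⟨i, hi⟩ := hlb u
  have hlow : w.height < (α (a i)).height := by
    by_contra! hle
    have haw : α (a i) ≤ w :=
      Point.le_of_le_of_height_le (hb (a i) i le_rfl) (hi.trans hu) hle
    obtain ⟨z, -, hz⟩ := exists_map_eq_of_le hα hmono haw
    exact hw ⟨z, hz⟩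
  linarith [hα (a i), h i, hi.1]

theorem IsLabelling.exists_isGood (ha : IsLabelling a) (hlb : IsLabelling b)
    (h : ∀ i j, |inducedMatrix a i j - inducedMatrix b i j| ≤ ε) :
    ∃ α : T.Point → S.Point, IsGood ε α := by
  have hε : 0 ≤ ε := by
    obtain ⟨i, -⟩ := ha (Classical.arbitrary _)
    exact (abs_nonneg _).trans (h i i)
  have hab (i j : ι) : inducedMatrix a i j ≤ inducedMatrix b i j + ε := by
    linarith [le_of_abs_le (h i j)]
  obtain ⟨α, hα, hb⟩ := ha.exists_shift (b := b) fun i j => by linarith [neg_le_of_abs_le (h i j)]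
  have hmono := ha.monotone_shift hα hb
  have hfibre {u v : T.Point} (huv : α u = α v) : v ≤ u.ancestor (u.height + 2 * ε) :=
    ha.le_ancestor_of_shift_eq hε hα hb hab huv
  refine ⟨α, (lipschitzWith_of_monotone hα hmono).continuous, hα, ?_, fun w hw => ?_⟩
  · rintro _ ⟨x, rfl⟩
    obtain ⟨z, hz⟩ := Point.exists_isLUB (S := α ⁻¹' {α x}) ⟨x, rfl⟩
      ⟨_, fun y hy => hfibre (Eq.symm hy)⟩
    refine ⟨z, hz, fun u hu => ?_⟩
    have hzu : z ≤ u.ancestor (u.height + 2 * ε) :=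
      hz.2 fun y hy => hfibre ((Set.mem_singleton_iff.1 hu).trans (Eq.symm hy))
    have hheight : (u.ancestor (u.height + 2 * ε)).height = u.height + 2 * ε :=
      Point.height_ancestor_of_le (by linarith)
    linarith [hzu.1]
  · refine hlb.depth_le_of_notMem_range hmono hα hb (fun i => ?_) hw
    simpa only [inducedMatrix_self] using hab i i

theorem IsLabelling.interleavingDist_le (ha : IsLabelling a) (hb : IsLabelling b)
    (h : ∀ i j, |inducedMatrix a i j - inducedMatrix b i j| ≤ ε) :
    interleavingDist T S ≤ ENNReal.ofReal ε :=
  iInf₂_le ε (ha.exists_isGood hb h)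

end Labelling

variable {T T' : MergeTree} {δ : ℝ} {α : T.Point → T'.Point}

theorem exists_isLeast_map (hδ : ∀ x, (α x).height - x.height = δ) (hα : Monotone α)
    (w : T'.Point) : ∃ x, IsLeast (Set.range α ∩ Set.Ici w) (α x) := by
  have : Nonempty {v // v ≠ T.root} := ⟨⟨_, (Classical.arbitrary T.Point).base_ne_root⟩⟩
  obtain ⟨v, hv⟩ :=
    Finite.exists_min fun v : {v // v ≠ T.root} => (w ⊔ α (Point.ofVertex v)).height
  obtain ⟨x, -, hx⟩ :=
    exists_map_eq_of_le hδ hα (le_sup_right : _ ≤ w ⊔ α (Point.ofVertex v))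
  refine ⟨x, hx ▸ ⟨⟨x, hx⟩, Set.mem_Ici.2 le_sup_left⟩, ?_⟩
  rintro _ ⟨⟨y, rfl⟩, hy⟩
  have hsup : w ⊔ α (Point.ofVertex ⟨y.base, y.base_ne_root⟩) ≤ α y :=
    sup_le hy (hα y.ofVertex_base_le)
  rw [hx]
  exact Point.le_of_le_of_height_le le_sup_left hy ((hv _).trans hsup.1)

theorem range_inter_Ici_eq (hδ : ∀ x, (α x).height - x.height = δ) (hα : Monotone α)
    {w q : T'.Point} (hwq : w ≤ q) (hq : q ∉ Set.range α) :
    Set.range α ∩ Set.Ici w = Set.range α ∩ Set.Ici q := by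
  refine Set.Subset.antisymm ?_ (Set.inter_subset_inter_right _ (Set.Ici_subset_Ici.2 hwq))
  rintro _ ⟨⟨x, rfl⟩, hx⟩
  refine ⟨⟨x, rfl⟩, (Point.total_of_le hx hwq).resolve_left fun hxq => hq ?_⟩
  obtain ⟨z, -, hz⟩ := exists_map_eq_of_le hδ hα hxq
  exact ⟨z, hz⟩

namespace IsGood

theorem nonneg (hα : IsGood δ α) : 0 ≤ δ := by
  let x : T.Point := Classical.arbitrary _
  obtain ⟨x', hx', hle⟩ := hα.fibre (α x) ⟨x, rfl⟩
  linarith [hle x rfl, Point.height_mono (hx'.1 (rfl : x ∈ α ⁻¹' {α x}))]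

theorem monotone (hα : IsGood δ α) : Monotone α := monotone_of_continuous hα.shift hα.continuous

theorem height_sup_le_add {x y : T.Point} {q : T'.Point} (hα : IsGood δ α) (hx : α x ≤ q)
    (hy : α y ≤ q) : (x ⊔ y).height ≤ q.height + δ := by
  obtain ⟨x₁, hxx₁, hx₁⟩ := exists_map_eq_of_le hα.shift hα.monotone hx
  obtain ⟨y₁, hyy₁, hy₁⟩ := exists_map_eq_of_le hα.shift hα.monotone hy
  obtain ⟨z, hz, hle⟩ := hα.fibre q ⟨x₁, hx₁⟩
  have hsup : x ⊔ y ≤ z := sup_le (hxx₁.trans (hz.1 hx₁)) (hyy₁.trans (hz.1 hy₁))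
  have hshift := hα.shift x₁
  rw [hx₁] at hshift
  linarith [hsup.1, hle x₁ hx₁]

theorem height_sup_le_height_sup_add {x y : T.Point} {w z : T'.Point} (hα : IsGood δ α)
    (hx : w ≤ α x) (hy : z ≤ α y) : (w ⊔ z).height ≤ (x ⊔ y).height + δ := by
  have hsup : w ⊔ z ≤ α (x ⊔ y) :=
    sup_le (hx.trans (hα.monotone le_sup_left)) (hy.trans (hα.monotone le_sup_right))
  linarith [hsup.1, hα.shift (x ⊔ y)]

theorem height_le_of_isLeast {w c : T'.Point} (hα : IsGood δ α)
    (hc : IsLeast (Set.range α ∩ Set.Ici w) c) : c.height ≤ w.height + 2 * δ := by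
  refine le_of_forall_lt_imp_le_of_dense fun t ht => ?_
  rcases le_or_gt t w.height with htw | hwt
  · linarith [hα.nonneg]
  have hheight : (w.ancestor t).height = t := Point.height_ancestor_of_le hwt.le
  have hrange : w.ancestor t ∉ Set.range α := fun h => by
    linarith [Point.height_mono (hc.2 ⟨h, w.le_ancestor t⟩)]
  linarith [Point.depth_le_iff.1 (hα.depth_le _ hrange) w (w.le_ancestor t)]

/-- A chosen preimage of the lowest ancestor of `w` in the image of `α`. -/
noncomputable def pullback (hα : IsGood δ α) (w : T'.Point) : T.Point :=
  (exists_isLeast_map hα.shift hα.monotone w).choose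

theorem isLeast_map_pullback (hα : IsGood δ α) (w : T'.Point) :
    IsLeast (Set.range α ∩ Set.Ici w) (α (hα.pullback w)) :=
  (exists_isLeast_map hα.shift hα.monotone w).choose_spec

theorem pullback_eq_pullback {w q : T'.Point} (hα : IsGood δ α) (hwq : w ≤ q)
    (hq : q ∉ Set.range α) : hα.pullback w = hα.pullback q := by
  simp only [pullback, range_inter_Ici_eq hα.shift hα.monotone hwq hq]

/-- The correspondence between `|T|` and `|T'|` given by a good map: the graph of the map together
with the pairs of a point of `|T'|` and its pullback. -/
def Corresponds (hα : IsGood δ α) (x : T.Point) (w : T'.Point) : Prop :=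
  α x = w ∨ x = hα.pullback w

namespace Corresponds

variable {hα : IsGood δ α} {x y : T.Point} {w z q : T'.Point}

theorem isLeast (h : hα.Corresponds x w) : IsLeast (Set.range α ∩ Set.Ici w) (α x) := by
  rcases h with rfl | rfl
  · exact ⟨⟨⟨x, rfl⟩, Set.self_mem_Ici⟩, fun _ hy => hy.2⟩
  · exact hα.isLeast_map_pullback w

theorem eq_pullback_of_le (h : hα.Corresponds x w) (hwq : w ≤ q) (hq : q ∉ Set.range α) :
    x = hα.pullback q := by
  rcases h with rfl | rfl
  · obtain ⟨u, -, hu⟩ := exists_map_eq_of_le hα.shift hα.monotone hwq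
    exact absurd ⟨u, hu⟩ hq
  · exact hα.pullback_eq_pullback hwq hq

theorem abs_height_sup_sub_le (hx : hα.Corresponds x w) (hy : hα.Corresponds y z) :
    |(x ⊔ y).height - (w ⊔ z).height| ≤ δ := by
  have hlow := hα.height_sup_le_height_sup_add hx.isLeast.1.2 hy.isLeast.1.2
  suffices (x ⊔ y).height ≤ (w ⊔ z).height + δ from
    abs_sub_le_iff.2 ⟨by linarith, by linarith⟩
  by_cases hq : w ⊔ z ∈ Set.range α
  · exact hα.height_sup_le_add (hx.isLeast.2 ⟨hq, Set.mem_Ici.2 le_sup_left⟩)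
      (hy.isLeast.2 ⟨hq, Set.mem_Ici.2 le_sup_right⟩)
  · rw [hx.eq_pullback_of_le le_sup_left hq, hy.eq_pullback_of_le le_sup_right hq, sup_idem]
    linarith [hα.shift (hα.pullback (w ⊔ z)),
      hα.height_le_of_isLeast (hα.isLeast_map_pullback (w ⊔ z))]

end Corresponds

theorem exists_isLabelling (hα : IsGood δ α) :
    ∃ (ι : Type) (_ : Finite ι) (a : ι → T.Point) (b : ι → T'.Point),
      IsLabelling a ∧ IsLabelling b ∧ ∀ i j, |inducedMatrix a i j - inducedMatrix b i j| ≤ δ := by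
  let a : {v // v ≠ T.root} ⊕ {v // v ≠ T'.root} → T.Point :=
    Sum.elim Point.ofVertex (hα.pullback ∘ Point.ofVertex)
  let b : {v // v ≠ T.root} ⊕ {v // v ≠ T'.root} → T'.Point :=
    Sum.elim (α ∘ Point.ofVertex) Point.ofVertex
  have hab : ∀ i, hα.Corresponds (a i) (b i) := Sum.rec (fun _ => Or.inl rfl) fun _ => Or.inr rfl
  refine ⟨_, inferInstance, a, b, fun x => ?_, fun w => ?_,
    fun i j => (hab i).abs_height_sup_sub_le (hab j)⟩
  · obtain ⟨v, hv⟩ := T.isLabelling_ofVertex x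
    exact ⟨Sum.inl v, hv⟩
  · obtain ⟨v, hv⟩ := T'.isLabelling_ofVertex w
    exact ⟨Sum.inr v, hv⟩

end IsGood

end MergeTree

/-- The symmetric matrices satisfying the ultrametric inequality, with no condition on the
diagonal. They are the matrices of the heights of the lowest common ancestors of labelled points. -/
structure IsUltraMatrix {ι R : Type*} [LinearOrder R] (U : ι → ι → R) : Prop where
  symm : ∀ i j, U i j = U j i
  le_max : ∀ i j k, U i k ≤ max (U i j) (U j k)

theorem IsUltraMatrix.diag_le {ι R : Type*} [LinearOrder R] {U : ι → ι → R}
    (hU : IsUltraMatrix U) (i j : ι) : U i i ≤ U i j := by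
  simpa only [hU.symm j i, max_self] using hU.le_max i j i

theorem MergeTree.isUltraMatrix_inducedMatrix {ι : Type*} {T : MergeTree} (a : ι → T.Point) :
    IsUltraMatrix (inducedMatrix a) where
  symm i j := by rw [inducedMatrix, inducedMatrix, sup_comm]
  le_max i j k := by
    rcases Point.total_of_le (le_sup_right : a j ≤ a i ⊔ a j) (le_sup_left : a j ≤ a j ⊔ a k)
      with h | h
    · exact le_max_of_le_right (Point.height_mono (sup_le (le_sup_left.trans h) le_sup_right))
    · exact le_max_of_le_left (Point.height_mono (sup_le le_sup_left (le_sup_right.trans h)))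

section TransGen

variable {ι R : Type*} [LinearOrder R] {M : ι → ι → R} {i j : ι} {r : R}

theorem IsUltraMatrix.le_of_transGen (hM : IsUltraMatrix M)
    (h : Relation.TransGen (fun k l => M k l ≤ r) i j) : M i j ≤ r := by
  induction h with
  | single h => exact h
  | tail _ h ih => exact (hM.le_max _ _ _).trans (max_le ih h)

theorem exists_entry_le_of_transGen [Finite ι] (h : Relation.TransGen (fun k l => M k l ≤ r) i j) :
    ∃ p : ι × ι, M p.1 p.2 ≤ r ∧ Relation.TransGen (fun k l => M k l ≤ M p.1 p.2) i j := by
  obtain ⟨k, hk, -⟩ := Relation.TransGen.head'_iff.1 h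
  let S : Set (ι × ι) := {p | M p.1 p.2 ≤ r}
  obtain ⟨p, hp, hmax⟩ := S.exists_max_image (fun p => M p.1 p.2) S.toFinite ⟨(i, k), hk⟩
  exact ⟨p, hp, Relation.TransGen.mono (fun k l hkl => hmax (k, l) hkl) _ _ h⟩

theorem exists_isLeast_transGen [Finite ι] (M : ι → ι → R) (i j : ι) :
    ∃ r, IsLeast {r | Relation.TransGen (fun k l => M k l ≤ r) i j} r := by
  let S : Set (ι × ι) := {p | Relation.TransGen (fun k l => M k l ≤ M p.1 p.2) i j}
  obtain ⟨p, hp, hmin⟩ :=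
    S.exists_min_image (fun p => M p.1 p.2) S.toFinite ⟨(i, j), .single le_rfl⟩
  refine ⟨M p.1 p.2, hp, fun r hr => ?_⟩
  obtain ⟨q, hqr, hq⟩ := exists_entry_le_of_transGen hr
  exact (hmin q hq).trans hqr

end TransGen

section UltraClosure

variable {ι R : Type*} [ConditionallyCompleteLinearOrder R] {M : ι → ι → R} {i j : ι} {r : R}

/-- The largest ultrametric matrix below a symmetric matrix: its entries are the lowest levels at
which two labels are joined by a chain of at least one step. -/
noncomputable def ultraClosure (M : ι → ι → R) (i j : ι) : R :=
  sInf {r | Relation.TransGen (fun k l => M k l ≤ r) i j}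

theorem ultraClosure_le_iff [Finite ι] :
    ultraClosure M i j ≤ r ↔ Relation.TransGen (fun k l => M k l ≤ r) i j := by
  obtain ⟨m, hm⟩ := exists_isLeast_transGen M i j
  rw [ultraClosure, hm.csInf_eq]
  exact ⟨fun h => Relation.TransGen.mono (fun _ _ hkl => hkl.trans h) _ _ hm.1, fun h => hm.2 h⟩

theorem isUltraMatrix_ultraClosure [Finite ι] (hM : ∀ i j, M i j = M j i) :
    IsUltraMatrix (ultraClosure M) where
  symm i j := by
    refine eq_of_forall_ge_iff fun r => ?_
    have hswap : (Function.swap fun k l => M k l ≤ r) = fun k l => M k l ≤ r :=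
      funext₂ fun k l => congrArg (· ≤ r) (hM l k)
    rw [ultraClosure_le_iff, ultraClosure_le_iff, ← Relation.transGen_swap, hswap]
  le_max i j k := ultraClosure_le_iff.2
    ((ultraClosure_le_iff.1 (le_max_left _ _)).trans (ultraClosure_le_iff.1 (le_max_right _ _)))

theorem IsUltraMatrix.ultraClosure_eq [Finite ι] (hM : IsUltraMatrix M) : ultraClosure M = M :=
  funext₂ fun _ _ => eq_of_forall_ge_iff fun _ =>
    ultraClosure_le_iff.trans ⟨hM.le_of_transGen, fun h => .single h⟩

theorem ultraClosure_le_add [Finite ι] {M N : ι → ι → ℝ} {ε : ℝ}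
    (h : ∀ i j, M i j ≤ N i j + ε) (i j : ι) : ultraClosure M i j ≤ ultraClosure N i j + ε :=
  ultraClosure_le_iff.2 <| Relation.TransGen.mono
    (fun k l hkl => (h k l).trans (add_le_add_left hkl ε)) _ _ (ultraClosure_le_iff.1 le_rfl)

theorem abs_ultraClosure_sub_le [Finite ι] {M N : ι → ι → ℝ} {ε : ℝ}
    (h : ∀ i j, |M i j - N i j| ≤ ε) (i j : ι) :
    |ultraClosure M i j - ultraClosure N i j| ≤ ε := by
  have hMN := ultraClosure_le_add (M := M) (N := N) (ε := ε)
    (fun i j => by linarith [le_of_abs_le (h i j)]) i j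
  have hNM := ultraClosure_le_add (M := N) (N := M) (ε := ε)
    (fun i j => by linarith [neg_le_of_abs_le (h i j)]) i j
  exact abs_sub_le_iff.2 ⟨by linarith, by linarith⟩

end UltraClosure

section ParentGraph

variable {V α : Type*} [Preorder α] {parent : V → V} {root u v : V} {f : V → α}

/-- The graph whose edges join each vertex to its parent. A root is its own parent, which adds no
edge. -/
def parentGraph (parent : V → V) : SimpleGraph V := SimpleGraph.fromRel fun u v => parent u = v

theorem parentGraph_adj_iff (hroot : parent root = root)
    (hf : ∀ v, v ≠ root → f v < f (parent v)) :
    (parentGraph parent).Adj u v ↔ u ≠ root ∧ parent u = v ∨ v ≠ root ∧ parent v = u := by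
  have hne (w : V) : w ≠ parent w ↔ w ≠ root :=
    ⟨fun h hw => h (hw ▸ hroot.symm), fun h hw => (hf w h).ne (congrArg f hw)⟩
  rw [parentGraph, SimpleGraph.fromRel_adj, and_or_left]
  refine or_congr (and_congr_left fun h => h ▸ hne u) (and_congr_left fun h => ?_)
  rw [← h, ne_comm, hne]

theorem parentGraph_adj_and_lt_iff (hroot : parent root = root)
    (hf : ∀ v, v ≠ root → f v < f (parent v)) :
    (parentGraph parent).Adj u v ∧ f u < f v ↔ u ≠ root ∧ parent u = v := by
  rw [parentGraph_adj_iff hroot hf]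
  constructor
  · rintro ⟨h | ⟨hv, rfl⟩, hlt⟩
    · exact h
    · exact absurd hlt (hf v hv).not_gt
  · rintro ⟨hu, rfl⟩
    exact ⟨Or.inl ⟨hu, rfl⟩, hf u hu⟩

theorem parentGraph_reachable_root [Finite V] (hroot : parent root = root)
    (hf : ∀ v, v ≠ root → f v < f (parent v)) (v : V) : (parentGraph parent).Reachable v root := by
  by_contra hv
  obtain ⟨w, hw, hmax⟩ := (Set.toFinite {v | ¬ (parentGraph parent).Reachable v root}
    ).exists_maximalFor f _ ⟨v, hv⟩
  have hw_ne : w ≠ root := fun h => hw (h ▸ SimpleGraph.Reachable.refl _)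
  have hadj : (parentGraph parent).Adj w (parent w) :=
    (parentGraph_adj_iff hroot hf).2 (Or.inl ⟨hw_ne, rfl⟩)
  have hp : ¬ (parentGraph parent).Reachable (parent w) root :=
    fun h => hw (hadj.reachable.trans h)
  exact (hf w hw_ne).not_ge (hmax hp (hf w hw_ne).le)

theorem card_edgeSet_parentGraph_add_one_le [Finite V] (hroot : parent root = root)
    (hf : ∀ v, v ≠ root → f v < f (parent v)) :
    Nat.card (parentGraph parent).edgeSet + 1 ≤ Nat.card V := by
  classical
  let edge (v : {v // v ≠ root}) : (parentGraph parent).edgeSet :=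
    ⟨s(v.1, parent v), (parentGraph_adj_iff hroot hf).2 (Or.inl ⟨v.2, rfl⟩)⟩
  have hsurj : Function.Surjective edge := by
    rintro ⟨e, he⟩
    induction e using Sym2.ind with | _ u v => ?_
    rw [SimpleGraph.mem_edgeSet, parentGraph_adj_iff hroot hf] at he
    rcases he with ⟨hu, rfl⟩ | ⟨hv, rfl⟩
    · exact ⟨⟨u, hu⟩, rfl⟩
    · exact ⟨⟨v, hv⟩, Subtype.ext Sym2.eq_swap⟩
  calc Nat.card (parentGraph parent).edgeSet + 1
      ≤ Nat.card {v // v ≠ root} + 1 := by grw [Nat.card_le_card_of_surjective edge hsurj]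
    _ = Nat.card V := by
      rw [← Finite.card_option, Nat.card_congr (Equiv.optionSubtypeNe root)]

theorem isTree_parentGraph [Finite V] (hroot : parent root = root)
    (hf : ∀ v, v ≠ root → f v < f (parent v)) : (parentGraph parent).IsTree := by
  have hreach := parentGraph_reachable_root hroot hf
  have hconn : (parentGraph parent).Connected :=
    { preconnected := fun u v => (hreach u).trans (hreach v).symm
      nonempty := ⟨root⟩ }
  exact SimpleGraph.isTree_iff_connected_and_card.2 ⟨hconn,
    (card_edgeSet_parentGraph_add_one_le hroot hf).antisymm hconn.card_vert_le_card_edgeSet_add_one⟩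

end ParentGraph

namespace MergeTree

variable {V : Type} [Finite V] {f : V → WithTop ℝ} {parent : V → V} {root : V}

/-- The merge tree in which the higher neighbour of each vertex other than the root is its
parent. -/
def ofParent (hroot : parent root = root) (hf : ∀ v, v ≠ root → f v < f (parent v))
    (hchild : ∃! v, v ≠ root ∧ parent v = root) (htop : ∀ v, f v = ⊤ ↔ v = root) : MergeTree where
  V := V
  finite := inferInstance
  G := parentGraph parent
  isTree := isTree_parentGraph hroot hf
  root := root
  f := f
  f_ne_of_adj u v h := by
    rcases (parentGraph_adj_iff hroot hf).1 h with ⟨hu, rfl⟩ | ⟨hv, rfl⟩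
    · exact (hf u hu).ne
    · exact (hf v hv).ne'
  existsUnique_higher v hv := by
    simpa only [parentGraph_adj_and_lt_iff hroot hf, hv, ne_eq, not_false_eq_true, true_and]
      using existsUnique_eq'
  root_degree_one := by
    simpa only [parentGraph_adj_iff hroot hf, ne_eq, not_true_eq_false, false_and, false_or]
      using hchild
  f_eq_top_iff := htop

theorem up_ofParent_iff {hroot : parent root = root} {hf : ∀ v, v ≠ root → f v < f (parent v)}
    {hchild : ∃! v, v ≠ root ∧ parent v = root} {htop : ∀ v, f v = ⊤ ↔ v = root} {u v : V} :
    (ofParent hroot hf hchild htop).Up u v ↔ u ≠ root ∧ parent u = v :=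
  parentGraph_adj_and_lt_iff hroot hf

end MergeTree

namespace IsUltraMatrix

section Cluster

variable {ι L : Type*} [LinearOrder L] {E : ι → ι → L}

/-- At level `r`, the labels `i` with `E i i ≤ r` are grouped by the relation `E i j ≤ r`. -/
def clusterSetoid (hE : IsUltraMatrix E) : Setoid {p : ι × L // E p.1 p.1 ≤ p.2} where
  r p q := p.1.2 = q.1.2 ∧ E p.1.1 q.1.1 ≤ p.1.2
  iseqv :=
    { refl p := ⟨rfl, p.2⟩
      symm h := ⟨h.1.symm, (hE.symm _ _).trans_le (h.2.trans_eq h.1)⟩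
      trans h h' := ⟨h.1.trans h'.1,
        (hE.le_max _ _ _).trans (max_le h.2 (h'.2.trans_eq h.1.symm))⟩ }

/-- The vertices of the dendrogram of an ultrametric matrix: a level together with a class of
labels that have merged at this level. -/
def Cluster (hE : IsUltraMatrix E) : Type _ := Quotient hE.clusterSetoid

instance [Finite ι] [Finite L] (hE : IsUltraMatrix E) : Finite hE.Cluster :=
  inferInstanceAs (Finite (Quotient _))

/-- The cluster of the label `i` at the level `r`. -/
def cluster (hE : IsUltraMatrix E) (i : ι) (r : L) (hi : E i i ≤ r) : hE.Cluster :=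
  Quotient.mk _ ⟨(i, r), hi⟩

theorem exists_eq_cluster {hE : IsUltraMatrix E} (v : hE.Cluster) :
    ∃ i r hi, v = hE.cluster i r hi :=
  Quotient.inductionOn v fun p => ⟨p.1.1, p.1.2, p.2, rfl⟩

theorem cluster_eq_cluster_iff {hE : IsUltraMatrix E} {i j : ι} {r s : L} {hi : E i i ≤ r}
    {hj : E j j ≤ s} : hE.cluster i r hi = hE.cluster j s hj ↔ r = s ∧ E i j ≤ r :=
  Quotient.eq

namespace Cluster

variable {hE : IsUltraMatrix E}

/-- The level of a cluster. -/
def level : hE.Cluster → L := Quotient.lift (·.1.2) fun _ _ h => h.1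

theorem level_cluster {i : ι} {r : L} (hi : E i i ≤ r) : (hE.cluster i r hi).level = r := rfl

/-- The cluster at the next level that contains a given cluster. -/
def parent [SuccOrder L] : hE.Cluster → hE.Cluster :=
  Quotient.map (fun p => ⟨(p.1.1, Order.succ p.1.2), p.2.trans (Order.le_succ _)⟩)
    fun _ _ h => ⟨congrArg Order.succ h.1, h.2.trans (Order.le_succ _)⟩

theorem parent_cluster [SuccOrder L] {i : ι} {r : L} (hi : E i i ≤ r) :
    (hE.cluster i r hi).parent = hE.cluster i (Order.succ r) (hi.trans (Order.le_succ r)) := rfl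

theorem level_parent [SuccOrder L] (v : hE.Cluster) : v.parent.level = Order.succ v.level := by
  obtain ⟨i, r, hi, rfl⟩ := exists_eq_cluster v
  rfl

variable [OrderTop L] [Nonempty ι]

/-- The cluster of all labels at the top level. -/
noncomputable def root : hE.Cluster := hE.cluster (Classical.arbitrary ι) ⊤ le_top

theorem level_eq_top_iff {v : hE.Cluster} : v.level = ⊤ ↔ v = root := by
  obtain ⟨i, r, hi, rfl⟩ := exists_eq_cluster v
  rw [level_cluster, root, cluster_eq_cluster_iff]
  exact ⟨fun h => ⟨h, le_top.trans_eq h.symm⟩, And.left⟩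

variable [SuccOrder L]

theorem parent_root : (root : hE.Cluster).parent = root := by
  rw [← level_eq_top_iff, level_parent, level_eq_top_iff.2 rfl, Order.succ_top]

theorem level_lt_level_parent {v : hE.Cluster} (hv : v ≠ root) : v.level < v.parent.level := by
  rw [level_parent, Order.lt_succ_iff_not_isMax, isMax_iff_eq_top, level_eq_top_iff]
  exact hv

theorem existsUnique_parent_eq_root [PredOrder L] (hlt : ∀ i j, E i j < ⊤) :
    ∃! v : hE.Cluster, v ≠ root ∧ v.parent = root := by
  let i := Classical.arbitrary ι
  have hpred (j : ι) : E i j ≤ Order.pred ⊤ := Order.le_pred_of_lt (hlt i j)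
  simp only [ne_eq, ← level_eq_top_iff, level_parent]
  refine ⟨hE.cluster i (Order.pred ⊤) (hpred i), ⟨?_, ?_⟩, fun v hv => ?_⟩
  · exact (Order.pred_lt_of_not_isMin fun h => (hlt i i).not_ge (h le_top)).ne
  · exact Order.succ_pred_of_not_isMin fun h => (hlt i i).not_ge (h le_top)
  · obtain ⟨j, s, hj, rfl⟩ := exists_eq_cluster v
    rw [level_cluster] at hv
    have hs : s = Order.pred ⊤ := by
      rw [← hv.2, Order.pred_succ_of_not_isMax fun h => hv.1 h.eq_top]
    exact cluster_eq_cluster_iff.2 ⟨hs, hE.symm j i ▸ hs ▸ hpred j⟩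

end Cluster

end Cluster

section MergeTree

variable {ι : Type} {U : ι → ι → ℝ}

/-- The heights of the vertices of the merge tree of `U`. -/
def levels (U : ι → ι → ℝ) : Set (WithTop ℝ) :=
  insert ⊤ (Set.range fun p : ι × ι => (U p.1 p.2 : WithTop ℝ))

/-- An entry of `U` as a level. -/
def entry (U : ι → ι → ℝ) (i j : ι) : levels U := ⟨U i j, Set.mem_insert_of_mem _ ⟨(i, j), rfl⟩⟩

instance : OrderTop (levels U) where
  top := ⟨⊤, Set.mem_insert _ _⟩
  le_top r := le_top (a := (r : WithTop ℝ))

theorem entry_le_entry_iff {i j k l : ι} : entry U i j ≤ entry U k l ↔ U i j ≤ U k l :=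
  WithTop.coe_le_coe

theorem entry_lt_top (i j : ι) : entry U i j < ⊤ := WithTop.coe_lt_top (U i j)

theorem isUltraMatrix_entry (hU : IsUltraMatrix U) : IsUltraMatrix (entry U) where
  symm i j := Subtype.ext (congrArg WithTop.some (hU.symm i j))
  le_max i j k := by
    simpa only [le_max_iff, entry_le_entry_iff] using hU.le_max i j k

variable [Finite ι]

instance : Finite (levels U) := ((Set.finite_range _).insert _).to_subtype

noncomputable instance : SuccOrder (levels U) := .ofLinearWellFoundedLT _

noncomputable instance : PredOrder (levels U) := .ofLinearWellFoundedGT _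

variable [Nonempty ι]

/-- The merge tree of an ultrametric matrix: its dendrogram, with the vertices at the entries of
the matrix and at infinity. -/
noncomputable def mergeTree (hU : IsUltraMatrix U) : MergeTree :=
  MergeTree.ofParent (V := hU.isUltraMatrix_entry.Cluster) (f := fun v => (v.level : WithTop ℝ))
    Cluster.parent_root (fun _ hv => Cluster.level_lt_level_parent hv)
    (Cluster.existsUnique_parent_eq_root entry_lt_top)
    fun v => Subtype.ext_iff.symm.trans (Cluster.level_eq_top_iff (v := v))

theorem up_mergeTree_iff {hU : IsUltraMatrix U} {u v : hU.isUltraMatrix_entry.Cluster} :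
    hU.mergeTree.Up u v ↔ u ≠ Cluster.root ∧ u.parent = v :=
  MergeTree.up_ofParent_iff

theorem below_cluster_of_le {hU : IsUltraMatrix U} {i : ι} {r s : levels U} (hi : entry U i i ≤ r)
    (hrs : r ≤ s) : hU.mergeTree.Below (hU.isUltraMatrix_entry.cluster i r hi)
      (hU.isUltraMatrix_entry.cluster i s (hi.trans hrs)) := by
  induction hrs using Succ.rec with
  | rfl => exact .refl
  | succ s hrs ih =>
    by_cases hs : hU.isUltraMatrix_entry.cluster i s (hi.trans hrs) = Cluster.root
    · have hparent := Cluster.parent_cluster (hE := hU.isUltraMatrix_entry) (hi.trans hrs)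
      rw [hs, Cluster.parent_root] at hparent
      rwa [← hparent, ← hs]
    · exact ih.tail (up_mergeTree_iff.2 ⟨hs, Cluster.parent_cluster _⟩)

theorem eq_cluster_of_below {hU : IsUltraMatrix U} {i : ι} {r : levels U} (hi : entry U i i ≤ r)
    {v : hU.isUltraMatrix_entry.Cluster}
    (h : hU.mergeTree.Below (hU.isUltraMatrix_entry.cluster i r hi) v) :
    ∃ s hs, v = hU.isUltraMatrix_entry.cluster i s hs := by
  induction h with
  | refl => exact ⟨r, hi, rfl⟩
  | tail _ h ih =>
    obtain ⟨s, hs, rfl⟩ := ih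
    exact ⟨_, _, (up_mergeTree_iff.1 h).2.symm⟩

/-- The point of the merge tree of `U` at which the labels `i` and `j` merge. -/
noncomputable def mergePoint (hU : IsUltraMatrix U) (i j : ι) : hU.mergeTree.Point where
  base := hU.isUltraMatrix_entry.cluster i (entry U i j) (entry_le_entry_iff.2 (hU.diag_le i j))
  height := U i j
  f_le := le_rfl
  lt_f _ hv := hv.2

theorem mergePoint_comm (hU : IsUltraMatrix U) (i j : ι) :
    hU.mergePoint i j = hU.mergePoint j i :=
  MergeTree.Point.ext
    (cluster_eq_cluster_iff.2 ⟨hU.isUltraMatrix_entry.symm i j, le_rfl⟩) (hU.symm i j)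

theorem mergePoint_self_le (hU : IsUltraMatrix U) (i j : ι) :
    hU.mergePoint i i ≤ hU.mergePoint i j :=
  ⟨hU.diag_le i j, below_cluster_of_le le_rfl (entry_le_entry_iff.2 (hU.diag_le i j))⟩

theorem mergePoint_le {hU : IsUltraMatrix U} {i j : ι} {z : hU.mergeTree.Point}
    (hi : hU.mergePoint i i ≤ z) (hj : hU.mergePoint j j ≤ z) : hU.mergePoint i j ≤ z := by
  obtain ⟨r, hr, hir⟩ := eq_cluster_of_below _ hi.2
  obtain ⟨s, hs, hjs⟩ := eq_cluster_of_below _ hj.2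
  have hij : entry U i j ≤ r := (cluster_eq_cluster_iff.1 (hir.symm.trans hjs)).2
  have hz := z.f_le
  rw [hir] at hz
  refine ⟨WithTop.coe_le_coe.1 (le_trans (Subtype.coe_le_coe.2 hij) hz), ?_⟩
  rw [hir]
  exact below_cluster_of_le _ hij

theorem mergePoint_self_sup (hU : IsUltraMatrix U) (i j : ι) :
    hU.mergePoint i i ⊔ hU.mergePoint j j = hU.mergePoint i j :=
  le_antisymm
    (sup_le (hU.mergePoint_self_le i j) ((hU.mergePoint_self_le j i).trans_eq
      (hU.mergePoint_comm j i)))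
    (mergePoint_le le_sup_left le_sup_right)

theorem inducedMatrix_mergePoint (hU : IsUltraMatrix U) :
    MergeTree.inducedMatrix (fun i => hU.mergePoint i i) = U :=
  funext₂ fun i j => congrArg MergeTree.Point.height (hU.mergePoint_self_sup i j)

theorem isLabelling_mergePoint (hU : IsUltraMatrix U) :
    MergeTree.IsLabelling fun i => hU.mergePoint i i := by
  intro x
  obtain ⟨i, r, hi, hx⟩ := exists_eq_cluster (hE := hU.isUltraMatrix_entry) x.base
  have hxr := x.f_le
  rw [hx] at hxr
  refine ⟨i, WithTop.coe_le_coe.1 (le_trans (Subtype.coe_le_coe.2 hi) hxr), ?_⟩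
  rw [hx]
  exact below_cluster_of_le _ hi

theorem exists_isLabelling (hU : IsUltraMatrix U) :
    ∃ (T : MergeTree) (a : ι → T.Point),
      MergeTree.IsLabelling a ∧ MergeTree.inducedMatrix a = U :=
  ⟨_, _, hU.isLabelling_mergePoint, hU.inducedMatrix_mergePoint⟩

end MergeTree

end IsUltraMatrix

namespace MergeTree

variable {ι : Type} [Finite ι] {T T' : MergeTree} {a : ι → T.Point} {b : ι → T'.Point}

theorem IsLabelling.exists_inducedMatrix_eq_ultraClosure (ha : IsLabelling a) (hb : IsLabelling b)
    {M : unitInterval → ι → ι → ℝ} (hM : ∀ t i j, M t i j = M t j i)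
    (hM0 : M 0 = inducedMatrix a) (hM1 : M 1 = inducedMatrix b) :
    ∃ (γ : unitInterval → MergeTree) (c : ∀ t, ι → (γ t).Point), γ 0 = T ∧ γ 1 = T' ∧
      ∀ t, IsLabelling (c t) ∧ inducedMatrix (c t) = ultraClosure (M t) := by
  have : Nonempty ι := ⟨(ha (Classical.arbitrary _)).choose⟩
  have hex (t : unitInterval) : ∃ (S : MergeTree) (c : ι → S.Point), (t = 0 → S = T) ∧
      (t = 1 → S = T') ∧ IsLabelling c ∧ inducedMatrix c = ultraClosure (M t) := by
    rcases eq_or_ne t 0 with rfl | h0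
    · refine ⟨T, a, fun _ => rfl, fun h => absurd h zero_ne_one, ha, ?_⟩
      rw [hM0, (isUltraMatrix_inducedMatrix a).ultraClosure_eq]
    rcases eq_or_ne t 1 with rfl | h1
    · refine ⟨T', b, fun h => absurd h h0, fun _ => rfl, hb, ?_⟩
      rw [hM1, (isUltraMatrix_inducedMatrix b).ultraClosure_eq]
    obtain ⟨S, c, hc⟩ := (isUltraMatrix_ultraClosure (hM t)).exists_isLabelling
    exact ⟨S, c, fun h => absurd h h0, fun h => absurd h h1, hc⟩
  choose γ c h0 h1 hc using hex
  exact ⟨γ, c, h0 0 rfl, h1 1 rfl, hc⟩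

theorem IsLabelling.exists_path (ha : IsLabelling a) (hb : IsLabelling b) {δ : ℝ}
    (h : ∀ i j, |inducedMatrix a i j - inducedMatrix b i j| ≤ δ) :
    ∃ γ : unitInterval → MergeTree, γ 0 = T ∧ γ 1 = T' ∧
      ∀ s t, interleavingDist (γ s) (γ t) ≤ ENNReal.ofReal δ * edist s t := by
  let M (t : unitInterval) (i j : ι) : ℝ :=
    AffineMap.lineMap (inducedMatrix a i j) (inducedMatrix b i j) (t : ℝ)
  have hlipschitz (s t : unitInterval) (i j : ι) : |M s i j - M t i j| ≤ δ * dist s t := by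
    rw [← Real.dist_eq, dist_lineMap_lineMap, mul_comm]
    exact mul_le_mul_of_nonneg_right (h i j) dist_nonneg
  have hsymm (t : unitInterval) (i j : ι) : M t i j = M t j i := by
    simp only [M, (isUltraMatrix_inducedMatrix _).symm i j]
  obtain ⟨γ, c, h0, h1, hc⟩ := ha.exists_inducedMatrix_eq_ultraClosure hb hsymm
    (funext₂ fun _ _ => AffineMap.lineMap_apply_zero _ _)
    (funext₂ fun _ _ => AffineMap.lineMap_apply_one _ _)
  refine ⟨γ, h0, h1, fun s t => ?_⟩
  rw [edist_dist, ← ENNReal.ofReal_mul' dist_nonneg]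
  refine (hc s).1.interleavingDist_le (hc t).1 ?_
  rw [(hc s).2, (hc t).2]
  exact abs_ultraClosure_sub_le (hlipschitz s t)

end MergeTree

section IntrinsicDist

open scoped NNReal

variable {X : Type*} {d : X → X → ℝ≥0∞} {γ : unitInterval → X}

theorem le_pathLength (d : X → X → ℝ≥0∞) (γ : unitInterval → X) :
    d (γ 0) (γ 1) ≤ pathLength d γ := by
  let t : ℕ → unitInterval := fun i => if i = 0 then 0 else 1
  have ht : Monotone t ∧ t 0 = 0 ∧ t 1 = 1 :=
    ⟨monotone_nat_of_le_succ fun _ => unitInterval.le_one', rfl, rfl⟩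
  refine le_iSup_of_le 1 (le_iSup₂_of_le t ht ?_)
  rw [Finset.sum_range_one, ht.2.1, ht.2.2]

theorem le_intrinsicDist (d : X → X → ℝ≥0∞) (x y : X) : d x y ≤ intrinsicDist d x y := by
  refine le_iInf₂ ?_
  rintro γ ⟨-, rfl, rfl⟩
  exact le_pathLength d γ

variable {C : ℝ≥0}

theorem continuousPath_of_le (h : ∀ s t, d (γ s) (γ t) ≤ C * edist s t) : ContinuousPath d γ := by
  intro t
  have hlim : Filter.Tendsto (fun s => C * edist t s) (𝓝 t) (𝓝 0) := by
    have hcont : Continuous fun s => C * edist t s :=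
      (ENNReal.continuous_const_mul ENNReal.coe_ne_top).comp (by fun_prop)
    simpa only [edist_self, mul_zero] using hcont.tendsto t
  exact tendsto_of_tendsto_of_tendsto_of_le_of_le tendsto_const_nhds hlim (fun _ => zero_le)
    (h t)

theorem pathLength_le (h : ∀ s t, d (γ s) (γ t) ≤ C * edist s t) : pathLength d γ ≤ C := by
  refine iSup_le fun n => iSup₂_le fun t ⟨hmono, h0, hn⟩ => ?_
  have hnonneg (i : ℕ) : (0 : ℝ) ≤ t (i + 1) - t i := sub_nonneg.2 (hmono i.le_succ)
  have hstep (i : ℕ) : edist (t i) (t (i + 1)) = ENNReal.ofReal (t (i + 1) - t i) := by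
    rw [edist_comm, edist_dist, Subtype.dist_eq, Real.dist_eq, abs_of_nonneg (hnonneg i)]
  calc ∑ i ∈ Finset.range n, d (γ (t i)) (γ (t (i + 1)))
      ≤ ∑ i ∈ Finset.range n, C * edist (t i) (t (i + 1)) := Finset.sum_le_sum fun i _ => h _ _
    _ = C * ENNReal.ofReal (∑ i ∈ Finset.range n, ((t (i + 1) : ℝ) - t i)) := by
        simp only [hstep]
        rw [← Finset.mul_sum, ENNReal.ofReal_sum_of_nonneg fun i _ => hnonneg i]
    _ = C := by
        rw [Finset.sum_range_sub fun i => (t i : ℝ), h0, hn, Set.Icc.coe_one, Set.Icc.coe_zero,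
          sub_zero, ENNReal.ofReal_one, mul_one]

theorem intrinsicDist_le (h : ∀ s t, d (γ s) (γ t) ≤ C * edist s t) :
    intrinsicDist d (γ 0) (γ 1) ≤ C :=
  iInf₂_le_of_le γ ⟨continuousPath_of_le h, rfl, rfl⟩ (pathLength_le h)

end IntrinsicDist

/-- The interleaving distance on the space of finite merge trees coincides with the intrinsic
metric that it induces. -/
theorem mainTheorem1 (T T' : MTSpace) :
    MTSpace.dI T T' = intrinsicDist MTSpace.dI T T' := by
  refine le_antisymm (le_intrinsicDist _ _ _) ?_
  induction T, T' using Quotient.inductionOn₂ with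
  | _ T T' =>
  refine le_iInf₂ fun δ ⟨α, hα⟩ => ?_
  obtain ⟨ι, _, a, b, ha, hb, hab⟩ := hα.exists_isLabelling
  obtain ⟨γ, rfl, rfl, hγ⟩ := ha.exists_path hb hab
  exact intrinsicDist_le (γ := fun t => Quotient.mk MergeTree.same (γ t)) hγ
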